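/- Let $Z_1,\dots,Z_{T+1}$ be a stochastic process with values in $\mathcal Z=\mathcal X\times\mathcal Y$, on a probability space, with regular conditional distributions $p_t(\cdot\mid z_1^{t-1})$ of $Z_t$ given $Z_1^{t-1}=(Z_1,\dots,Z_{t-1})$; no stationarity or mixing is assumed. Conditional expectations are taken with respect to them: $\mathbb E[f(Z_t)\mid Z_1^{t-1}]=\int f\,dp_t(\cdot\mid Z_1^{t-1})$. Let $L\colon\mathcal Y\times\mathcal Y\to[0,\infty)$ be a loss function, $H$ a set of functions $h\colon\mathcal X\to\mathcal Y$, and $\mathcal F=\{(x,y)\mapsto L(h(x),y) : h\in H\}$. Assume that $|f|\le M$ for all $f\in\mathcal F$, and that $\mathcal F$ is a measurable class: its members are measurable and, for all $n$ and all $a\in\mathbb R^n$, the map $(z_1,\dots,z_n)\mapsto\sup_{f\in\mathcal F}\sum_i a_i f(z_i)$ is measurable with respect to the completion of every finite measure (this is automatic if $\mathcal F$ is a countable set of measurable functions). Let $\mathbf q=(q_1,\dots,q_T)\in\mathbb R^T$ be fixed weights (of any sign) and put $$\mathrm{disc}(\mathbf q)=\sup_{f\in\mathcal F}\Big(\mathbb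 E[f(Z_{T+1})\mid Z_1^T]-\sum_{t=1}^T q_t\,\mathbb E[f(Z_t)\mid Z_1^{t-1}]\Big).$$ A $\mathcal Z$-valued tree of depth $T$ is a sequence $\mathbf v=(v_1,\dots,v_T)$ of maps $v_t\colon\{\pm1\}^{t-1}\to\mathcal Z$; for $\sigma\in\{\pm1\}^T$ write $v_t(\sigma)=v_t(\sigma_1,\dots,\sigma_{t-1})$. A set $V$ of real-valued trees of depth $T$ is a sequential $\alpha$-cover of $\mathcal F$ on $\mathbf v$ if for all $f\in\mathcal F$ and $\sigma\in\{\pm1\}^T$ there is $c\in V$ with $\sum_{t=1}^T|c_t(\sigma)-f(v_t(\sigma))|\le\alpha/\|\mathbf q\|_\infty$ (where $\alpha/0=\infty$), and $\mathcal N_1(\alpha,\mathcal F,\mathbf v)\in\{0,1,\dots,\infty\}$ is the smallest cardinality of such a $V$. The law $T(p)$ of a random tree is defined as follows: draw $Z_1,Z_1'$ independently from $p_1$ at the root and then, at the node reached by the path $(\sigma_1,\dots,\sigma_{t-1})$, draw $Z_t,Z_t'$ independently from $p_t(\cdot\mid S_1(\sigma_1),\dots,S_{t-1}(\sigma_{t-1}))$,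 where $S_s(1)=Z_s$ and $S_s(-1)=Z_s'$ are the draws at the $s$-th node of that path, independently at distinct nodes of the same level given the earlier levels; the tree $\mathbf v$ consists of the unprimed draws $Z_t$. Then for every $\delta>0$, with probability at least $1-\delta$, the following holds simultaneously for all $f\in\mathcal F$ and all $\alpha>0$: $$\mathbb E[f(Z_{T+1})\mid Z_1^T]\le\sum_{t=1}^T q_t f(Z_t)+\mathrm{disc}(\mathbf q)+2\alpha+M\|\mathbf q\|_2\sqrt{2\log\frac{\mathbb E_{\mathbf v\sim T(p)}[\mathcal N_1(\alpha,\mathcal F,\mathbf v)]}{\delta}},$$ where the right-hand side is read as $+\infty$ if the expected covering number is infinite. -/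

import Mathlib

open MeasureTheory ProbabilityTheory
open scoped ENNReal

namespace TimeSeries

/-- The family of loss functions `(x, y) ↦ L (h x) y`, `h ∈ H`. -/
def lossClass {𝒳 𝒴 : Type*} (L : 𝒴 → 𝒴 → ℝ) (H : Set (𝒳 → 𝒴)) : Set (𝒳 × 𝒴 → ℝ) :=
  (fun (h : 𝒳 → 𝒴) (z : 𝒳 × 𝒴) => L (h z.1) z.2) '' H

/-- The standing measurability convention on a class of functions that may be uncountable: its
members are measurable, and the suprema over the class of finite weighted sums
`∑ i, a i * f (z i)` are universally measurable functions of the points `z`. It holds for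
countable classes, and for pointwise separable classes of measurable functions. -/
def MeasurableClass {Z : Type*} [MeasurableSpace Z] (F : Set (Z → ℝ)) : Prop :=
  (∀ f ∈ F, Measurable f) ∧
    ∀ (n : ℕ) (a : Fin n → ℝ) (ν : Measure (Fin n → Z)), IsFiniteMeasure ν →
      AEMeasurable (fun z : Fin n → Z => ⨆ f : F, ∑ i, a i * f.1 (z i)) ν

/-! ### Stochastic processes

Times are counted from `0`: `Z k` is the observation at time `k + 1`. -/

/-- The first `k` terms of a sequence. -/
def history {Z : Type*} (z : ℕ → Z) (k : ℕ) : Fin k → Z := fun i => z i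

/-- `p k` is, for each `k ≤ T`, a regular version of the conditional distribution of `Z k` given
the past `(Z 0, …, Z (k - 1))`. -/
def IsCondLaw {Ω Z : Type*} [MeasurableSpace Ω] [MeasurableSpace Z] (μ : Measure Ω) (T : ℕ)
    (Zp : ℕ → Ω → Z) (p : (k : ℕ) → Kernel (Fin k → Z) Z) : Prop :=
  ∀ k ≤ T, μ.map (fun ω => (history (fun i => Zp i ω) k, Zp k ω)) =
    (μ.map (fun ω => history (fun i => Zp i ω) k)) ⊗ₘ p k

/-- The conditional expectation of `f (Z k)` given the past, on the sample path `z`. -/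
noncomputable def condMean {Z : Type*} [MeasurableSpace Z] (p : (k : ℕ) → Kernel (Fin k → Z) Z)
    (f : Z → ℝ) (k : ℕ) (z : ℕ → Z) : ℝ :=
  ∫ y, f y ∂(p k (history z k))

/-- The discrepancy `disc(q)`, on the sample path `z`. -/
noncomputable def disc {Z : Type*} [MeasurableSpace Z] (p : (k : ℕ) → Kernel (Fin k → Z) Z)
    (F : Set (Z → ℝ)) {T : ℕ} (q : Fin T → ℝ) (z : ℕ → Z) : ℝ :=
  ⨆ f : F, (condMean p f.1 T z - ∑ t : Fin T, q t * condMean p f.1 t z)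

/-! ### Binary trees and sequential covers

A sign is a `Bool`; `true` stands for `+1` and `false` for `-1`. -/

/-- Complete binary trees of depth `T` with values in `Z`; the `t`-th level is a function of the
first `t` signs (`t = 0, …, T - 1`). -/
abbrev BinTree (T : ℕ) (Z : Type*) := (t : Fin T) → (Fin t → Bool) → Z

/-- The label `z_t(σ)` met at level `t` along the path `σ`. -/
def BinTree.along {T : ℕ} {Z : Type*} (z : BinTree T Z) (σ : Fin T → Bool) (t : Fin T) : Z :=
  z t (fun i => σ (Fin.castLE t.isLt.le i))

/-- The tree with root label `r` and with subtree `left` below the sign `+1`, `right` below the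
sign `-1`. -/
def BinTree.node {T : ℕ} {Z : Type*} (r : Z) (left right : BinTree T Z) : BinTree (T + 1) Z :=
  Fin.cases (fun _ => r)
    (fun t (σ : Fin (t + 1) → Bool) => (if σ 0 then left else right) t (fun i => σ i.succ))

/-- `V` is a sequential `α`-cover, in the `q`-weighted `ℓ₁` norm, of the class `G` on the tree
`z`. In `Fin T → ℝ`, `‖q‖` is the sup norm, which is dual to the `ℓ₁` norm; the inequality is
`∑ t, |v_t(σ) - g(z_t(σ))| ≤ ‖q‖⁻¹ α`, with `0⁻¹ = ∞`. -/
def IsSeqCover {T : ℕ} {Z : Type*} (q : Fin T → ℝ) (α : ℝ) (G : Set (Z → ℝ)) (z : BinTree T Z)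
    (V : Set (BinTree T ℝ)) : Prop :=
  ∀ g ∈ G, ∀ σ : Fin T → Bool, ∃ v ∈ V,
    ‖q‖ * ∑ t : Fin T, |v.along σ t - g (z.along σ t)| ≤ α

/-- The sequential covering number `𝒩₁(α, G, z)`. -/
noncomputable def coveringNumber {T : ℕ} {Z : Type*} (q : Fin T → ℝ) (α : ℝ) (G : Set (Z → ℝ))
    (z : BinTree T Z) : ℕ∞ :=
  ⨅ (V : Set (BinTree T ℝ)) (_ : IsSeqCover q α G z V), V.encard

/-! ### The random tree -/

theorem measurable_snoc {Z : Type*} [MeasurableSpace Z] (k : ℕ) :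
    Measurable (fun x : (Fin k → Z) × Z => (Fin.snoc x.1 x.2 : Fin (k + 1) → Z)) := by
  refine measurable_pi_lambda _ fun i => ?_
  induction i using Fin.lastCases with
  | last => simpa using measurable_snd
  | cast i =>
    simp only [Fin.snoc_castSucc]
    fun_prop

theorem BinTree.measurable_node {T : ℕ} {Z : Type*} [MeasurableSpace Z] :
    Measurable (fun x : Z × BinTree T Z × BinTree T Z => BinTree.node x.1 x.2.1 x.2.2) := by
  refine measurable_pi_lambda _ fun t => measurable_pi_lambda _ fun σ => ?_
  induction t using Fin.cases with
  | zero => exact measurable_fst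
  | succ t =>
    simp only [BinTree.node, Fin.cases_succ]
    by_cases hσ : σ (0 : Fin ((t : ℕ) + 1)) = true
    · simp only [if_pos hσ]
      fun_prop
    · simp only [if_neg hσ]
      fun_prop

/-- The law of the random `Z × Z`-valued tree of depth `n` that starts after the history `h` of
length `k`: the root label `(z, z')` consists of two independent draws from `p k h`; given it, the
subtree below `+1` is drawn in the same way after the history `(h, z)` and the subtree below `-1`
after the history `(h, z')`, independently of each other. -/
noncomputable def pairTreeLaw {Z : Type*} [MeasurableSpace Z]
    (p : (k : ℕ) → Kernel (Fin k → Z) Z) :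
    (n k : ℕ) → Kernel (Fin k → Z) (BinTree n (Z × Z))
  | 0, _ => Kernel.const _ (Measure.dirac (fun t => t.elim0))
  | n + 1, k =>
    ((p k ×ₖ p k) ⊗ₖ
      ((pairTreeLaw p n (k + 1)).comap
          (fun x : (Fin k → Z) × (Z × Z) => (Fin.snoc x.1 x.2.1 : Fin (k + 1) → Z))
          ((measurable_snoc k).comp (by fun_prop : Measurable
            fun x : (Fin k → Z) × (Z × Z) => (x.1, x.2.1))) ×ₖ
        (pairTreeLaw p n (k + 1)).comap
          (fun x : (Fin k → Z) × (Z × Z) => (Fin.snoc x.1 x.2.2 : Fin (k + 1) → Z))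
          ((measurable_snoc k).comp (by fun_prop : Measurable
            fun x : (Fin k → Z) × (Z × Z) => (x.1, x.2.2))))).map
      (fun x => BinTree.node x.1 x.2.1 x.2.2)

instance isMarkovKernel_pairTreeLaw {Z : Type*} [MeasurableSpace Z]
    (p : (k : ℕ) → Kernel (Fin k → Z) Z) [∀ k, IsMarkovKernel (p k)] (n k : ℕ) :
    IsMarkovKernel (pairTreeLaw p n k) := by
  induction n generalizing k with
  | zero => rw [pairTreeLaw]; infer_instance
  | succ n ih =>
    rw [pairTreeLaw]
    exact Kernel.IsMarkovKernel.map _ BinTree.measurable_node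

/-- The law `T(p)` of the `Z`-valued tree formed by the first components. -/
noncomputable def treeLaw {Z : Type*} [MeasurableSpace Z] (p : (k : ℕ) → Kernel (Fin k → Z) Z)
    (T : ℕ) : Measure (BinTree T Z) :=
  (pairTreeLaw p T 0 (fun i => i.elim0)).map (fun w t σ => (w t σ).1)

/-- The expected sequential covering number `E_{v ∼ T(p)} [𝒩₁(α, G, v)]`, which may be `∞`. -/
noncomputable def expectedCoveringNumber {Z : Type*} [MeasurableSpace Z]
    (p : (k : ℕ) → Kernel (Fin k → Z) Z) {T : ℕ} (q : Fin T → ℝ) (α : ℝ) (G : Set (Z → ℝ)) :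
    ℝ≥0∞ :=
  ∫⁻ v, (coveringNumber q α G v : ℝ≥0∞) ∂(treeLaw p T)

end TimeSeries

/-! By the definition of the discrepancy it suffices to control the supremum over the class of the
martingale deviation `∑ q_t (E[f(Z_t) | past] - f(Z_t))`, through its exponential moment at rate
`l`. Jensen's inequality replaces the conditional means by a tangent sequence `Z'`, drawn
independently from the same conditional laws (`exp_le_lintegral_expSup`). As `Z_t` and `Z'_t` are
exchangeable given the past, the process and its tangent sequence are jointly distributed as the
selected and rejected entries along any sign path of the random tree of pairs
(`lintegral_seqLaw_tangentLaw`). Averaging over paths brings in Rademacher signs. The supremum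
splits into one over first components and one over second components. These have the same
exponential moments, because exchanging components and signs preserves the law of the tree
(`map_flip_pairTreeLaw`); separating them by `2ab ≤ a² + b²` doubles the rate to `2l`.

On a fixed tree a cover replaces the class by finitely many Rademacher martingales, at cost `α`, and
each has a sub-Gaussian moment (`sum_exp_tree_le`). Losses lie in `[0, M]`, so centring at `M / 2`
halves the increments and offsets the doubled rate. The result is `E[N] exp(2lα + l² M² ‖q‖₂² / 2)`;
Markov's inequality and the best `l` settle a single `α`. Uniformity in `α` costs nothing, since the
thresholds are deterministic and the deviation events are nested (`measure_exists_lt_le`). -/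

namespace TimeSeries

/-! ### Rademacher averages on a fixed tree -/

/-- The real value of a sign. -/
noncomputable def sgn (b : Bool) : ℝ := if b then 1 else -1

theorem sgn_not (b : Bool) : sgn (!b) = -sgn b := by cases b <;> simp [sgn]

theorem abs_sgn (b : Bool) : |sgn b| = 1 := by cases b <;> simp [sgn]

/-- The subtree below the sign `s` at the root. -/
def BinTree.subtree {n : ℕ} {Z : Type*} (c : BinTree (n + 1) Z) (s : Bool) : BinTree n Z :=
  fun t τ => c t.succ (Fin.cons s τ : Fin (t + 1) → Bool)

theorem BinTree.along_cons_succ {n : ℕ} {Z : Type*} (c : BinTree (n + 1) Z) (s : Bool)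
    (σ : Fin n → Bool) (t : Fin n) :
    c.along (Fin.cons s σ) t.succ = (c.subtree s).along σ t := by
  unfold BinTree.along BinTree.subtree
  congr 1
  funext i
  refine Fin.cases ?_ (fun j => ?_) i
  · rfl
  · rfl

theorem sum_sign_cons {n : ℕ} {A : Type*} [AddCommMonoid A] (f : (Fin (n + 1) → Bool) → A) :
    ∑ σ, f σ = ∑ σ : Fin n → Bool, f (Fin.cons true σ) +
      ∑ σ : Fin n → Bool, f (Fin.cons false σ) := by
  rw [← (Fin.consEquiv (fun _ : Fin (n + 1) => Bool)).sum_comp, Fintype.sum_prod_type]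
  simp [Fin.consEquiv]

/-- The exponential moment bound for a Rademacher martingale given by a tree. -/
theorem sum_exp_tree_le {n : ℕ} (c : BinTree n ℝ) (b : Fin n → ℝ) (h : ∀ t s, |c t s| ≤ b t) :
    ∑ σ, Real.exp (∑ t, sgn (σ t) * c.along σ t) ≤ 2 ^ n * Real.exp (∑ t, b t ^ 2 / 2) := by
  induction n with
  | zero => simp
  | succ n ih =>
    -- Once the first sign is fixed, the remaining sum lives on a subtree, and its bound does not
    -- depend on that sign.
    have key : ∀ s : Bool, ∑ σ : Fin n → Bool,
        Real.exp (∑ t, sgn ((Fin.cons s σ : Fin (n + 1) → Bool) t) * c.along (Fin.cons s σ) t) ≤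
        Real.exp (sgn s * c 0 (fun i => i.elim0)) *
          (2 ^ n * Real.exp (∑ t : Fin n, b t.succ ^ 2 / 2)) := by
      intro s
      refine le_trans (le_of_eq ?_) (mul_le_mul_of_nonneg_left
        (ih (c.subtree s) (fun t => b t.succ) fun t τ => h t.succ _) (Real.exp_nonneg _))
      rw [Finset.mul_sum]
      refine Finset.sum_congr rfl fun σ _ => ?_
      rw [← Real.exp_add, Fin.sum_univ_succ]
      simp only [Fin.cons_zero, Fin.cons_succ, BinTree.along_cons_succ]
      congr 3
      unfold BinTree.along
      congr 1
      funext i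
      exact i.elim0
    rw [sum_sign_cons]
    refine (add_le_add (key true) (key false)).trans ?_
    rw [← add_mul, Fin.sum_univ_succ, Real.exp_add]
    set x := c 0 (fun i => i.elim0) with hx
    have hcosh : Real.exp (sgn true * x) + Real.exp (sgn false * x) ≤
        2 * Real.exp (b 0 ^ 2 / 2) := by
      have h1 := Real.cosh_le_exp_half_sq x
      rw [Real.cosh_eq] at h1
      have h2 : x ^ 2 ≤ b 0 ^ 2 := sq_le_sq' (by linarith [abs_le.1 (h 0 fun i => i.elim0)])
        (abs_le.1 (h 0 fun i => i.elim0)).2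
      have h3 : Real.exp (x ^ 2 / 2) ≤ Real.exp (b 0 ^ 2 / 2) := Real.exp_le_exp.2 (by linarith)
      simp only [sgn, if_true, one_mul, neg_mul, Bool.false_eq_true, if_false]
      linarith
    refine (mul_le_mul_of_nonneg_right hcosh (by positivity)).trans (le_of_eq ?_)
    ring

/-- The supremum over the class of a weighted sum of values at given points. -/
noncomputable def wsup {Z : Type*} (F : Set (Z → ℝ)) {n : ℕ} (a : Fin n → ℝ) (z : Fin n → Z) : ℝ :=
  ⨆ f : F, ∑ i, a i * f.1 (z i)

theorem bddAbove_wsum {Z : Type*} {F : Set (Z → ℝ)} {M : ℝ} (hM : ∀ f ∈ F, ∀ z, |f z| ≤ M) {n : ℕ}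
    (a : Fin n → ℝ) (z : Fin n → Z) :
    BddAbove (Set.range fun f : F => ∑ i, a i * f.1 (z i)) := by
  refine ⟨∑ i, |a i| * M, ?_⟩
  rintro _ ⟨f, rfl⟩
  refine Finset.sum_le_sum fun i _ => (le_abs_self _).trans ?_
  rw [abs_mul]
  exact mul_le_mul_of_nonneg_left (hM _ f.2 _) (abs_nonneg _)

theorem le_wsup {Z : Type*} {F : Set (Z → ℝ)} {M : ℝ} (hM : ∀ f ∈ F, ∀ z, |f z| ≤ M) {n : ℕ}
    (a : Fin n → ℝ) (z : Fin n → Z) {f : Z → ℝ} (hf : f ∈ F) :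
    ∑ i, a i * f (z i) ≤ wsup F a z :=
  le_ciSup (bddAbove_wsum hM a z) ⟨f, hf⟩

/-- Along each path, every member of the class is `α`-close to some element of the cover, so the
exponential of the supremum is at most the sum of the exponentials over the cover. Each summand is
then a Rademacher martingale. The added term centres the class at `M / 2`. -/
theorem sum_exp_wsup_le_of_cover {Z : Type*} {F : Set (Z → ℝ)} (hne : F.Nonempty) {M : ℝ}
    (hM0 : 0 ≤ M) (h0 : ∀ f ∈ F, ∀ z, 0 ≤ f z) (hM : ∀ f ∈ F, ∀ z, f z ≤ M) {n : ℕ} (q : Fin n → ℝ) {α l : ℝ}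
    (hl : 0 < l) (v : BinTree n Z) (V : Finset (BinTree n ℝ)) (hV : IsSeqCover q α F v V) :
    ∑ σ, Real.exp (l * (wsup F (fun t => -(sgn (σ t) * q t)) (v.along σ) +
        ∑ t, sgn (σ t) * q t * (M / 2))) ≤
      2 ^ n * (V.card * Real.exp (l * α + ∑ t, (l * |q t| * (M / 2)) ^ 2 / 2)) := by
  -- Cover elements may take any real values. Clipping to `[0, M]` brings them no further from the
  -- class and bounds them after centring.
  let clip : ℝ → ℝ := fun x => max 0 (min x M)
  have hclip : ∀ x, |clip x - M / 2| ≤ M / 2 := by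
    intro x
    have h1 : 0 ≤ clip x := le_max_left _ _
    have h2 : clip x ≤ M := max_le hM0 (min_le_right _ _)
    exact abs_le.2 ⟨by linarith, by linarith⟩
  have hclip' : ∀ x y, 0 ≤ y → y ≤ M → |clip x - y| ≤ |x - y| := by
    intro x y h1 h2
    simp only [clip]
    have h3 := le_abs_self (x - y)
    have h4 := neg_abs_le (x - y)
    refine abs_le.2 ⟨?_, ?_⟩ <;>
      rcases max_cases 0 (min x M) with ⟨h, h'⟩ | ⟨h, h'⟩ <;> rw [h] <;>
      rcases min_cases x M with ⟨h'', h'''⟩ | ⟨h'', h'''⟩ <;> rw [h''] at h' <;>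
      (try rw [h'']) <;> linarith
  let w : BinTree n ℝ → BinTree n ℝ := fun c t s => -(l * q t * (clip (c t s) - M / 2))
  have key : ∀ σ : Fin n → Bool,
      Real.exp (l * (wsup F (fun t => -(sgn (σ t) * q t)) (v.along σ) +
        ∑ t, sgn (σ t) * q t * (M / 2))) ≤
      ∑ c ∈ V, Real.exp (l * α) * Real.exp (∑ t, sgn (σ t) * (w c).along σ t) := by
    intro σ
    set R := ∑ c ∈ V, Real.exp (l * α) * Real.exp (∑ t, sgn (σ t) * (w c).along σ t) with hR
    have hfR : ∀ f ∈ F, Real.exp (l * (∑ t, -(sgn (σ t) * q t) * f (v.along σ t) +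
        ∑ t, sgn (σ t) * q t * (M / 2))) ≤ R := by
      intro f hf
      obtain ⟨c, hc, hcα⟩ := hV f hf σ
      refine le_trans ?_ (Finset.single_le_sum (fun c _ => by positivity) hc)
      rw [← Real.exp_add, Real.exp_le_exp]
      have h1 : ∑ t, sgn (σ t) * (w c).along σ t = l * (∑ t, -(sgn (σ t) * q t) *
          (clip (c.along σ t)) + ∑ t, sgn (σ t) * q t * (M / 2)) := by
        rw [← Finset.sum_add_distrib, Finset.mul_sum]
        refine Finset.sum_congr rfl fun t _ => ?_
        simp only [w, BinTree.along]
        ring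
      rw [h1, ← mul_add]
      refine mul_le_mul_of_nonneg_left ?_ hl.le
      rw [← add_assoc]
      refine add_le_add_left (le_trans ?_ (add_le_add_left hcα _)) _
      rw [Finset.mul_sum, ← Finset.sum_add_distrib]
      refine Finset.sum_le_sum fun t _ => ?_
      have h2 : sgn (σ t) * q t * (clip (c.along σ t) - f (v.along σ t)) ≤
          ‖q‖ * |c.along σ t - f (v.along σ t)| := by
        refine (le_abs_self _).trans ?_
        rw [abs_mul, abs_mul, abs_sgn, one_mul]
        exact mul_le_mul (norm_le_pi_norm q t) (hclip' _ _ (h0 f hf _) (hM f hf _)) (abs_nonneg _)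
          (norm_nonneg _)
      linarith
    have hRpos : 0 < R := by
      obtain ⟨f, hf⟩ := hne
      exact (Real.exp_pos _).trans_le (hfR f hf)
    -- The supremum need not be attained, so the bound is moved through the logarithm and checked on
    -- each `f`.
    rw [← Real.le_log_iff_exp_le hRpos, ← le_div_iff₀' hl, ← le_sub_iff_add_le]
    have : Nonempty F := hne.to_subtype
    refine ciSup_le fun f => ?_
    rw [le_sub_iff_add_le, le_div_iff₀' hl, Real.le_log_iff_exp_le hRpos]
    exact hfR f.1 f.2
  refine (Finset.sum_le_sum fun σ _ => key σ).trans ?_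
  rw [Finset.sum_comm]
  have hc : ∀ c ∈ V, ∑ σ : Fin n → Bool,
      Real.exp (l * α) * Real.exp (∑ t, sgn (σ t) * (w c).along σ t) ≤
      Real.exp (l * α) * (2 ^ n * Real.exp (∑ t, (l * |q t| * (M / 2)) ^ 2 / 2)) := by
    intro c _
    rw [← Finset.mul_sum]
    refine mul_le_mul_of_nonneg_left (sum_exp_tree_le (w c) _ fun t s => ?_) (Real.exp_nonneg _)
    simp only [w]
    rw [abs_neg, abs_mul, abs_mul, abs_of_pos hl]
    exact mul_le_mul_of_nonneg_left (hclip _) (by positivity)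
  refine (Finset.sum_le_sum hc).trans (le_of_eq ?_)
  rw [Finset.sum_const, nsmul_eq_mul, Real.exp_add]
  ring

theorem avg_exp_wsup_le_coveringNumber {Z : Type*} {F : Set (Z → ℝ)} (hne : F.Nonempty) {M : ℝ}
    (hM0 : 0 ≤ M) (h0 : ∀ f ∈ F, ∀ z, 0 ≤ f z) (hM : ∀ f ∈ F, ∀ z, f z ≤ M) {n : ℕ}
    (q : Fin n → ℝ) {α l : ℝ} (hl : 0 < l) (v : BinTree n Z) :
    (2 ^ n)⁻¹ * ∑ σ, ENNReal.ofReal (Real.exp (l * (wsup F (fun t => -(sgn (σ t) * q t))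
        (v.along σ) + ∑ t, sgn (σ t) * q t * (M / 2)))) ≤
      (coveringNumber q α F v : ℝ≥0∞) *
        ENNReal.ofReal (Real.exp (l * α + ∑ t, (l * |q t| * (M / 2)) ^ 2 / 2)) := by
  set C := Real.exp (l * α + ∑ t, (l * |q t| * (M / 2)) ^ 2 / 2)
  have hC : 0 < C := Real.exp_pos _
  rcases eq_or_ne (coveringNumber q α F v) ⊤ with htop | hfin
  · rw [htop, ENat.toENNReal_top, ENNReal.top_mul (by simpa using hC)]
    exact le_top
  -- The infimum is attained because `ℕ∞` is well-ordered.
  obtain ⟨V, hV, hVN⟩ : ∃ V, IsSeqCover q α F v V ∧ V.encard = coveringNumber q α F v := by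
    have h1 : coveringNumber q α F v = sInf (Set.encard '' {V | IsSeqCover q α F v V}) := by
      rw [sInf_image]
      rfl
    have h2 : (Set.encard '' {V | IsSeqCover q α F v V}).Nonempty := by
      by_contra h
      rw [Set.not_nonempty_iff_eq_empty] at h
      exact hfin (by rw [h1, h, sInf_empty])
    obtain ⟨V, hV, h3⟩ := csInf_mem h2
    exact ⟨V, hV, h3.trans h1.symm⟩
  have hVf : V.Finite := by
    rw [← Set.encard_ne_top_iff, hVN]
    exact hfin
  have h := sum_exp_wsup_le_of_cover hne hM0 h0 hM q hl v hVf.toFinset (α := α) (by simpa using hV)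
  have hcard : (coveringNumber q α F v : ℝ≥0∞) = ENNReal.ofReal hVf.toFinset.card := by
    rw [← hVN, hVf.encard_eq_coe_toFinset_card]
    simp
  rw [hcard, ← ENNReal.ofReal_mul (by positivity), ← ENNReal.ofReal_sum_of_nonneg
    fun σ _ => (Real.exp_nonneg _)]
  refine (mul_le_mul_right (ENNReal.ofReal_le_ofReal h) _).trans (le_of_eq ?_)
  rw [ENNReal.ofReal_mul (by positivity), ← mul_assoc, ENNReal.ofReal_pow (by norm_num)]
  rw [ENNReal.ofReal_ofNat, ENNReal.inv_mul_cancel (by simp) (by simp), one_mul]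

theorem one_le_coveringNumber {Z : Type*} {F : Set (Z → ℝ)} (hne : F.Nonempty) {n : ℕ}
    (q : Fin n → ℝ) (α : ℝ) (v : BinTree n Z) : 1 ≤ coveringNumber q α F v := by
  refine le_iInf₂ fun V hV => ?_
  obtain ⟨f, hf⟩ := hne
  obtain ⟨c, hc, -⟩ := hV f hf fun _ => true
  exact Set.one_le_encard_iff_nonempty.2 ⟨c, hc⟩

/-! ### Laws of the process, its tangent sequence and the random tree -/

section Laws

variable {Z : Type*} [MeasurableSpace Z]

theorem measurable_cons (n : ℕ) :
    Measurable (fun x : Z × (Fin n → Z) => (Fin.cons x.1 x.2 : Fin (n + 1) → Z)) := by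
  refine measurable_pi_lambda _ fun i => ?_
  induction i using Fin.cases with
  | zero => exact measurable_fst
  | succ i => simp only [Fin.cons_succ]; fun_prop

@[fun_prop]
theorem measurable_cons_comp {A : Type*} [MeasurableSpace A] {n : ℕ} {f : A → Z}
    {g : A → Fin n → Z} (hf : Measurable f) (hg : Measurable g) :
    Measurable (fun a => (Fin.cons (f a) (g a) : Fin (n + 1) → Z)) :=
  (measurable_cons n).comp (hf.prodMk hg)

@[fun_prop]
theorem measurable_snoc_comp {A : Type*} [MeasurableSpace A] {n : ℕ} {f : A → Fin n → Z}
    {g : A → Z} (hf : Measurable f) (hg : Measurable g) :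
    Measurable (fun a => (Fin.snoc (f a) (g a) : Fin (n + 1) → Z)) :=
  (measurable_snoc n).comp (hf.prodMk hg)

@[fun_prop]
theorem measurable_node_comp {A : Type*} [MeasurableSpace A] {n : ℕ} {f : A → Z}
    {g h : A → BinTree n Z} (hf : Measurable f) (hg : Measurable g) (hh : Measurable h) :
    Measurable (fun a => BinTree.node (f a) (g a) (h a)) :=
  BinTree.measurable_node.comp (hf.prodMk (hg.prodMk hh))

theorem measurable_lintegral_kernel_comp {A B C : Type*} [MeasurableSpace A] [MeasurableSpace B]
    [MeasurableSpace C] (κ : Kernel B C) [IsSFiniteKernel κ] {g : A → B} (hg : Measurable g)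
    {f : A → C → ℝ≥0∞} (hf : Measurable fun x : A × C => f x.1 x.2) :
    Measurable fun a => ∫⁻ c, f a c ∂(κ (g a)) :=
  Measurable.lintegral_kernel_prod_right (κ := κ.comap g hg) hf

/-- The conditional law of the next `n` observations given the history of length `k`. -/
noncomputable def seqLaw (p : (k : ℕ) → Kernel (Fin k → Z) Z) :
    (n k : ℕ) → Kernel (Fin k → Z) (Fin n → Z)
  | 0, _ => Kernel.const _ (Measure.dirac Fin.elim0)
  | n + 1, k => ((p k) ⊗ₖ ((seqLaw p n (k + 1)).comap
      (fun x : (Fin k → Z) × Z => (Fin.snoc x.1 x.2 : Fin (k + 1) → Z)) (measurable_snoc k))).map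
      (fun x : Z × (Fin n → Z) => (Fin.cons x.1 x.2 : Fin (n + 1) → Z))

/-- The law of the decoupled tangent sequence: given the history of length `k` and the next `n`
observations, its terms are independent draws from the conditional laws. -/
noncomputable def tangentLaw (p : (k : ℕ) → Kernel (Fin k → Z) Z) :
    (n k : ℕ) → Kernel ((Fin k → Z) × (Fin n → Z)) (Fin n → Z)
  | 0, _ => Kernel.const _ (Measure.dirac Fin.elim0)
  | n + 1, k => ((p k).comap Prod.fst measurable_fst ×ₖ (tangentLaw p n (k + 1)).comap
      (fun x : (Fin k → Z) × (Fin (n + 1) → Z) =>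
        ((Fin.snoc x.1 (x.2 0) : Fin (k + 1) → Z), fun i : Fin n => x.2 i.succ))
        (by fun_prop)).map
      (fun x : Z × (Fin n → Z) => (Fin.cons x.1 x.2 : Fin (n + 1) → Z))

variable (p : (k : ℕ) → Kernel (Fin k → Z) Z) [∀ k, IsMarkovKernel (p k)]

instance isMarkovKernel_seqLaw (n k : ℕ) : IsMarkovKernel (seqLaw p n k) := by
  induction n generalizing k with
  | zero => rw [seqLaw]; infer_instance
  | succ n ih =>
    rw [seqLaw]
    exact Kernel.IsMarkovKernel.map _ (measurable_cons n)

instance isMarkovKernel_tangentLaw (n k : ℕ) : IsMarkovKernel (tangentLaw p n k) := by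
  induction n generalizing k with
  | zero => rw [tangentLaw]; infer_instance
  | succ n ih =>
    rw [tangentLaw]
    exact Kernel.IsMarkovKernel.map _ (measurable_cons n)

theorem lintegral_seqLaw_succ (n k : ℕ) (h : Fin k → Z) {φ : (Fin (n + 1) → Z) → ℝ≥0∞}
    (hφ : Measurable φ) :
    ∫⁻ y, φ y ∂(seqLaw p (n + 1) k h) =
      ∫⁻ x, ∫⁻ y, φ (Fin.cons x y) ∂(seqLaw p n (k + 1) (Fin.snoc h x)) ∂(p k h) := by
  rw [seqLaw, Kernel.lintegral_map _ (measurable_cons n) _ hφ,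
    Kernel.lintegral_compProd]
  · rfl
  · fun_prop

theorem lintegral_tangentLaw_succ (n k : ℕ) (h : Fin k → Z) (z : Fin (n + 1) → Z)
    {φ : (Fin (n + 1) → Z) → ℝ≥0∞} (hφ : Measurable φ) :
    ∫⁻ y, φ y ∂(tangentLaw p (n + 1) k (h, z)) =
      ∫⁻ x, ∫⁻ y, φ (Fin.cons x y)
        ∂(tangentLaw p n (k + 1) (Fin.snoc h (z 0), fun i => z i.succ)) ∂(p k h) := by
  rw [tangentLaw, Kernel.lintegral_map _ (measurable_cons n) _ hφ,
    Kernel.lintegral_prod]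
  · rfl
  · fun_prop

theorem lintegral_pairTreeLaw_succ (n k : ℕ) (h : Fin k → Z)
    {φ : BinTree (n + 1) (Z × Z) → ℝ≥0∞} (hφ : Measurable φ) :
    ∫⁻ w, φ w ∂(pairTreeLaw p (n + 1) k h) =
      ∫⁻ x, ∫⁻ x', ∫⁻ l, ∫⁻ r, φ (BinTree.node (x, x') l r)
        ∂(pairTreeLaw p n (k + 1) (Fin.snoc h x')) ∂(pairTreeLaw p n (k + 1) (Fin.snoc h x))
        ∂(p k h) ∂(p k h) := by
  rw [pairTreeLaw, Kernel.lintegral_map _ BinTree.measurable_node _ hφ,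
    Kernel.lintegral_compProd, Kernel.lintegral_prod]
  · refine lintegral_congr fun x => lintegral_congr fun x' => ?_
    rw [Kernel.lintegral_prod]
    · rfl
    · fun_prop
  · exact measurable_lintegral_kernel_comp _ (by fun_prop) (by fun_prop)
  · fun_prop

/-- The hypothesis describes one step at a time; chaining the steps identifies the law of a whole
block given its past, hence of the sample `Z_1, …, Z_T`. -/
theorem lintegral_process {Ω : Type*} [MeasurableSpace Ω] (μ : Measure Ω) [IsProbabilityMeasure μ]
    {T : ℕ} {X : ℕ → Ω → Z} (hX : ∀ k, Measurable (X k)) (hp : IsCondLaw μ T X p) (n j : ℕ)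
    (hj : j + n ≤ T) {φ : (Fin j → Z) × (Fin n → Z) → ℝ≥0∞} (hφ : Measurable φ) :
    ∫⁻ ω, φ (history (fun i => X i ω) j, fun i => X (j + i) ω) ∂μ =
      ∫⁻ ω, ∫⁻ y, φ (history (fun i => X i ω) j, y) ∂(seqLaw p n j (history (fun i => X i ω) j))
        ∂μ := by
  have hh : ∀ k, Measurable fun ω => history (fun i => X i ω) k := fun k =>
    measurable_pi_lambda _ fun i => hX i
  induction n generalizing j with
  | zero =>
    refine lintegral_congr fun ω => ?_
    rw [seqLaw, Kernel.const_apply, lintegral_dirac' _ (by fun_prop)]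
    congr 2
    exact Subsingleton.elim _ _
  | succ n ih =>
    have h1 := ih (j + 1) (by omega) (φ := fun a => φ (fun i => a.1 i.castSucc,
      Fin.cons (a.1 (Fin.last j)) a.2)) (by fun_prop)
    have h2 : ∀ ω, (history (fun i => X i ω) (j + 1)) =
        Fin.snoc (history (fun i => X i ω) j) (X j ω) := by
      intro ω
      funext i
      induction i using Fin.lastCases <;> simp [history]
    have h3 : ∀ ω, (fun i : Fin (n + 1) => X (j + i) ω) =
        Fin.cons (X j ω) (fun i : Fin n => X (j + 1 + i) ω) := by
      intro ω
      funext i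
      induction i using Fin.cases with
      | zero => rfl
      | succ i => simp [add_assoc, add_comm 1]
    simp only [h2, Fin.snoc_castSucc, Fin.snoc_last] at h1
    simp only [h3]
    refine h1.trans ?_
    have h6 : ∀ ω, ∫⁻ y, φ (history (fun i => X i ω) j, y)
        ∂(seqLaw p (n + 1) j (history (fun i => X i ω) j)) = _ := fun ω =>
      lintegral_seqLaw_succ p n j _ (by fun_prop)
    simp only [h6]
    have h4 : Measurable fun x : (Fin j → Z) × Z => ∫⁻ y, φ (x.1, Fin.cons x.2 y)
        ∂(seqLaw p n (j + 1) (Fin.snoc x.1 x.2)) :=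
      measurable_lintegral_kernel_comp _ (by fun_prop) (by fun_prop)
    have h5 := congrArg (fun ν => ∫⁻ x, ∫⁻ y, φ (x.1, Fin.cons x.2 y)
        ∂(seqLaw p n (j + 1) (Fin.snoc x.1 x.2)) ∂ν) (hp j (by omega))
    rw [lintegral_map h4 ((hh j).prodMk (hX j)), Measure.lintegral_compProd h4, lintegral_map
      (Measurable.lintegral_kernel_prod_right' h4) (hh j)] at h5
    exact h5

end Laws

/-! ### Decoupling: tangent pairs as paths in the tree of pairs -/

section Decoupling

variable {Z : Type*}

/-- The history selected by the signs `σ` along the path `σ` in a tree of pairs. -/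
def BinTree.path {n : ℕ} (w : BinTree n (Z × Z)) (σ : Fin n → Bool) : Fin n → Z :=
  fun t => if σ t then (w.along σ t).1 else (w.along σ t).2

/-- The elements not selected by the signs `σ` along the path `σ` in a tree of pairs. -/
def BinTree.copath {n : ℕ} (w : BinTree n (Z × Z)) (σ : Fin n → Bool) : Fin n → Z :=
  fun t => if σ t then (w.along σ t).2 else (w.along σ t).1

/-- The tree in which the components of all labels and the signs are exchanged. -/
def BinTree.flip {n : ℕ} (w : BinTree n (Z × Z)) : BinTree n (Z × Z) :=
  fun t σ => (w t fun i => !σ i).swap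

theorem BinTree.path_node {n : ℕ} (x x' : Z) (l r : BinTree n (Z × Z)) (s : Bool)
    (σ : Fin n → Bool) :
    (BinTree.node (x, x') l r).path (Fin.cons s σ) =
      Fin.cons (if s then x else x') ((if s then l else r).path σ) := by
  funext t
  induction t using Fin.cases with
  | zero => rfl
  | succ t => rfl

theorem BinTree.copath_node {n : ℕ} (x x' : Z) (l r : BinTree n (Z × Z)) (s : Bool)
    (σ : Fin n → Bool) :
    (BinTree.node (x, x') l r).copath (Fin.cons s σ) =
      Fin.cons (if s then x' else x) ((if s then l else r).copath σ) := by
  funext t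
  induction t using Fin.cases with
  | zero => rfl
  | succ t => rfl

theorem BinTree.flip_node {n : ℕ} (x x' : Z) (l r : BinTree n (Z × Z)) :
    (BinTree.node (x, x') l r).flip = BinTree.node (x', x) r.flip l.flip := by
  funext t σ
  induction t using Fin.cases with
  | zero => rfl
  | succ t =>
    simp only [BinTree.flip, BinTree.node, Fin.cases_succ]
    have key : ∀ (b : Bool) (τ : Fin t → Bool),
        ((if (!b) = true then l else r) t fun i => !τ i).swap =
        (if b = true then r.flip else l.flip) t τ := by
      intro b τ
      cases b <;> rfl
    exact key _ _

variable [MeasurableSpace Z]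

@[fun_prop]
theorem BinTree.measurable_along {A : Type*} [MeasurableSpace A] {n : ℕ} (σ : Fin n → Bool) :
    Measurable fun w : BinTree n A => w.along σ :=
  measurable_pi_lambda _ fun t => by unfold BinTree.along; fun_prop

@[fun_prop]
theorem BinTree.measurable_path {n : ℕ} (σ : Fin n → Bool) :
    Measurable fun w : BinTree n (Z × Z) => w.path σ := by
  refine measurable_pi_lambda _ fun t => ?_
  unfold BinTree.path BinTree.along
  cases σ t
  · simp only [Bool.false_eq_true, if_false]; fun_prop
  · simp only [if_true]; fun_prop

@[fun_prop]
theorem BinTree.measurable_copath {n : ℕ} (σ : Fin n → Bool) :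
    Measurable fun w : BinTree n (Z × Z) => w.copath σ := by
  refine measurable_pi_lambda _ fun t => ?_
  unfold BinTree.copath BinTree.along
  cases σ t
  · simp only [Bool.false_eq_true, if_false]; fun_prop
  · simp only [if_true]; fun_prop

@[fun_prop]
theorem BinTree.measurable_flip {n : ℕ} :
    Measurable fun w : BinTree n (Z × Z) => w.flip := by
  refine measurable_pi_lambda _ fun t => measurable_pi_lambda _ fun σ => ?_
  unfold BinTree.flip
  fun_prop

variable (p : (k : ℕ) → Kernel (Fin k → Z) Z) [∀ k, IsMarkovKernel (p k)]

/-- Below each node the tree continues from the history extended by the selected draw, just as the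
process does, and the rejected draw is an independent copy with the same past. Hence every sign path
gives the same joint law, and the average over paths is an average of equal terms. -/
theorem lintegral_seqLaw_tangentLaw (n k : ℕ) (h : Fin k → Z)
    {φ : (Fin n → Z) × (Fin n → Z) → ℝ≥0∞} (hφ : Measurable φ) :
    ∫⁻ y, ∫⁻ y', φ (y, y') ∂(tangentLaw p n k (h, y)) ∂(seqLaw p n k h) =
      (2 ^ n)⁻¹ * ∑ σ, ∫⁻ w, φ (w.path σ, w.copath σ) ∂(pairTreeLaw p n k h) := by
  induction n generalizing k with
  | zero =>
    have h1 : ∀ y y' : Fin 0 → Z, φ (y, y') = φ (Fin.elim0, Fin.elim0) := fun y y' => by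
      rw [Subsingleton.elim y Fin.elim0, Subsingleton.elim y' Fin.elim0]
    simp [h1]
  | succ n ih =>
    have hm' : ∀ σ : Fin n → Bool, Measurable fun a : Z × Z => ∫⁻ w, φ (Fin.cons a.1 (w.path σ),
        Fin.cons a.2 (w.copath σ)) ∂(pairTreeLaw p n (k + 1) (Fin.snoc h a.1)) := fun σ =>
      measurable_lintegral_kernel_comp _ (by fun_prop) (by fun_prop)
    have hm : ∀ σ : Fin n → Bool, Measurable fun x => ∫⁻ x', ∫⁻ w, φ (Fin.cons x (w.path σ),
        Fin.cons x' (w.copath σ)) ∂(pairTreeLaw p n (k + 1) (Fin.snoc h x)) ∂(p k h) := fun σ =>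
      (hm' σ).lintegral_prod_right'
    have hL : ∫⁻ y, ∫⁻ y', φ (y, y') ∂(tangentLaw p (n + 1) k (h, y)) ∂(seqLaw p (n + 1) k h) =
        (2 ^ n)⁻¹ * ∑ σ : Fin n → Bool, ∫⁻ x, ∫⁻ x', ∫⁻ w, φ (Fin.cons x (w.path σ),
          Fin.cons x' (w.copath σ)) ∂(pairTreeLaw p n (k + 1) (Fin.snoc h x)) ∂(p k h)
          ∂(p k h) := by
      rw [lintegral_seqLaw_succ p n k h (measurable_lintegral_kernel_comp _ (by fun_prop)
        (by fun_prop))]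
      have h1 : ∀ x y, ∫⁻ y', φ (Fin.cons x y, y') ∂(tangentLaw p (n + 1) k (h, Fin.cons x y)) =
          ∫⁻ x', ∫⁻ y', φ (Fin.cons x y, Fin.cons x' y')
            ∂(tangentLaw p n (k + 1) (Fin.snoc h x, y)) ∂(p k h) := fun x y =>
        lintegral_tangentLaw_succ p n k h _ (by fun_prop)
      simp only [h1]
      rw [← lintegral_finsetSum, ← lintegral_const_mul]
      · refine lintegral_congr fun x => ?_
        -- The tangent draw `x'` depends only on `h`, so it can be taken before the rest of the
        -- process; the inductive hypothesis then applies for fixed `x` and `x'`.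
        rw [lintegral_lintegral_swap]
        · rw [← lintegral_finsetSum, ← lintegral_const_mul]
          · exact lintegral_congr fun x' => ih (k + 1) (Fin.snoc h x)
              (φ := fun a => φ (Fin.cons x a.1, Fin.cons x' a.2)) (by fun_prop)
          · exact Finset.measurable_fun_sum _ fun σ _ => by fun_prop
          · fun_prop
        · exact (measurable_lintegral_kernel_comp _ (by fun_prop) (by fun_prop)).aemeasurable
      · exact Finset.measurable_fun_sum _ fun σ _ => hm σ
      · exact fun σ _ => hm σ
    have hT : ∀ σ : Fin n → Bool, ∫⁻ w, φ (w.path (Fin.cons true σ), w.copath (Fin.cons true σ))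
        ∂(pairTreeLaw p (n + 1) k h) = ∫⁻ x, ∫⁻ x', ∫⁻ w, φ (Fin.cons x (w.path σ),
          Fin.cons x' (w.copath σ)) ∂(pairTreeLaw p n (k + 1) (Fin.snoc h x)) ∂(p k h)
          ∂(p k h) := by
      intro σ
      rw [lintegral_pairTreeLaw_succ p n k h (by fun_prop)]
      simp [BinTree.path_node, BinTree.copath_node]
    -- Below the sign `-1` the roles of the two root draws are exchanged, which is harmless as they
    -- are independent and identically distributed.
    have hF : ∀ σ : Fin n → Bool, ∫⁻ w, φ (w.path (Fin.cons false σ), w.copath (Fin.cons false σ))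
        ∂(pairTreeLaw p (n + 1) k h) = ∫⁻ x, ∫⁻ x', ∫⁻ w, φ (Fin.cons x (w.path σ),
          Fin.cons x' (w.copath σ)) ∂(pairTreeLaw p n (k + 1) (Fin.snoc h x)) ∂(p k h)
          ∂(p k h) := by
      intro σ
      rw [lintegral_pairTreeLaw_succ p n k h (by fun_prop)]
      simp only [BinTree.path_node, BinTree.copath_node, Bool.false_eq_true, if_false,
        lintegral_const, measure_univ, mul_one]
      exact (lintegral_lintegral_swap (hm' σ).aemeasurable).symm
    rw [hL, sum_sign_cons]
    simp only [hT, hF]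
    rw [← two_mul, ← mul_assoc, pow_succ, ENNReal.mul_inv (by simp) (by simp), mul_assoc (_)⁻¹,
      ENNReal.inv_mul_cancel (by simp) (by simp), mul_one]

/-- Swapping the two root draws swaps the histories of the two subtrees, which is exactly what
exchanging the subtrees undoes. -/
theorem lintegral_flip_pairTreeLaw (n k : ℕ) (h : Fin k → Z)
    {φ : BinTree n (Z × Z) → ℝ≥0∞} (hφ : Measurable φ) :
    ∫⁻ w, φ w.flip ∂(pairTreeLaw p n k h) = ∫⁻ w, φ w ∂(pairTreeLaw p n k h) := by
  induction n generalizing k with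
  | zero => exact lintegral_congr fun w => congrArg φ (Subsingleton.elim _ _)
  | succ n ih =>
    rw [lintegral_pairTreeLaw_succ p n k h hφ, lintegral_pairTreeLaw_succ p n k h (by fun_prop),
      lintegral_lintegral_swap]
    · refine lintegral_congr fun x => lintegral_congr fun x' => ?_
      simp only [BinTree.flip_node]
      rw [lintegral_lintegral_swap]
      · have h1 : ∀ l : BinTree n (Z × Z), ∫⁻ r, φ (BinTree.node (x, x') l r.flip)
            ∂(pairTreeLaw p n (k + 1) (Fin.snoc h x')) = _ := fun l =>
          ih (k + 1) (Fin.snoc h x') (φ := fun r => φ (BinTree.node (x, x') l r)) (by fun_prop)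
        have h2 : ∀ r : BinTree n (Z × Z), ∫⁻ l, φ (BinTree.node (x, x') r.flip l.flip)
            ∂(pairTreeLaw p n (k + 1) (Fin.snoc h x')) = _ := fun r => h1 r.flip
        simp only [h2]
        exact ih (k + 1) (Fin.snoc h x) (φ := fun l => ∫⁻ r, φ (BinTree.node (x, x') l r)
            ∂(pairTreeLaw p n (k + 1) (Fin.snoc h x'))) (by fun_prop)
      · fun_prop
    · have h3 : Measurable fun a : (Z × Z) × BinTree n (Z × Z) =>
          ∫⁻ r, φ (BinTree.node (a.1.1, a.1.2) a.2 r).flip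
            ∂(pairTreeLaw p n (k + 1) (Fin.snoc h a.1.2)) :=
        measurable_lintegral_kernel_comp _ (by fun_prop) (by fun_prop)
      exact (measurable_lintegral_kernel_comp (A := Z × Z) (pairTreeLaw p n (k + 1))
        (g := fun a => Fin.snoc h a.1) (by fun_prop) h3).aemeasurable

theorem map_flip_pairTreeLaw (n k : ℕ) (h : Fin k → Z) :
    (pairTreeLaw p n k h).map BinTree.flip = pairTreeLaw p n k h :=
  Measure.ext_of_lintegral _ fun φ hφ => by
    rw [lintegral_map hφ BinTree.measurable_flip, lintegral_flip_pairTreeLaw p n k h hφ]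

/-- This is what makes the tangent sequence usable in Jensen's inequality: its marginals have the
conditional means as expectations. -/
theorem map_eval_tangentLaw (n k : ℕ) (z : ℕ → Z) (t : Fin n) (m : ℕ) (hm : m = k + t) :
    (tangentLaw p n k (history z k, fun i => z (k + i))).map (fun y => y t) =
      p m (history z m) := by
  refine Measure.ext_of_lintegral _ fun φ hφ => ?_
  rw [lintegral_map hφ (by fun_prop)]
  induction n generalizing k with
  | zero => exact t.elim0
  | succ n ih =>
    rw [lintegral_tangentLaw_succ p n k _ _ (by fun_prop)]
    induction t using Fin.cases with
    | zero =>
      obtain rfl : m = k := by simpa using hm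
      simp
    | succ t =>
      have h1 : (Fin.snoc (history z k) (z (k + (0 : Fin (n + 1)) )) : Fin (k + 1) → Z) =
          history z (k + 1) := by
        funext i
        induction i using Fin.lastCases <;> simp [history]
      have h2 : (fun i : Fin n => z (k + (i.succ : Fin (n + 1)))) = fun i : Fin n => z (k + 1 + i) := by
        funext i
        simp [add_assoc, add_comm 1]
      simp only [Fin.cons_succ, h1, h2]
      rw [ih (k + 1) t (by rw [hm, Fin.val_succ]; omega)]
      simp

end Decoupling

/-- Suprema over the class are only almost everywhere measurable, whereas disintegration along
kernels is applied to measurable integrands. The majorant holds everywhere, so it survives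
restriction to slices, and it leaves the integral unchanged. -/
theorem exists_measurable_majorant {A : Type*} [MeasurableSpace A] {ν : Measure A} {φ : A → ℝ≥0∞}
    (hφ : AEMeasurable φ ν) :
    ∃ G : A → ℝ≥0∞, Measurable G ∧ φ ≤ G ∧ ∫⁻ a, G a ∂ν = ∫⁻ a, φ a ∂ν := by
  classical
  obtain ⟨s, hs, hsm, hs0⟩ := exists_measurable_superset_of_null (ae_iff.1 hφ.ae_eq_mk)
  refine ⟨s.piecewise (fun _ => ∞) (hφ.mk φ),
    Measurable.piecewise hsm measurable_const hφ.measurable_mk, fun a => ?_, lintegral_congr_ae ?_⟩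
  · by_cases ha : a ∈ s
    · simp [ha]
    · rw [Set.piecewise_eq_of_notMem _ _ _ ha]
      by_contra h
      exact ha (hs fun h' => h h'.le)
  · have h1 : ∀ᵐ a ∂ν, a ∉ s := measure_eq_zero_iff_ae_notMem.1 hs0
    filter_upwards [h1, hφ.ae_eq_mk] with a h2 h3
    rw [Set.piecewise_eq_of_notMem _ _ _ h2, h3]

/-! ### Symmetrization and the exponential tail bound -/

section Symmetrization

variable {Z : Type*}

/-- The tree of first components. -/
def BinTree.fst {n : ℕ} (w : BinTree n (Z × Z)) : BinTree n Z := fun t σ => (w t σ).1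

/-- The exponential of `l` times the supremum over the class of `∑ i, q i * (f (z' i) - f (z i))`,
as a function of `(z, z')`. -/
noncomputable def expSup (F : Set (Z → ℝ)) {n : ℕ} (q : Fin n → ℝ) (l : ℝ)
    (a : (Fin n → Z) × (Fin n → Z)) : ℝ≥0∞ :=
  ENNReal.ofReal (Real.exp (l * wsup F (Fin.append (-q) q) (Fin.append a.1 a.2)))

/-- The exponential of `l` times the signed, centred supremum over the class along a path. -/
noncomputable def expSignedSup (F : Set (Z → ℝ)) (M : ℝ) {n : ℕ} (q : Fin n → ℝ) (l : ℝ)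
    (σ : Fin n → Bool) (v : BinTree n Z) : ℝ≥0∞ :=
  ENNReal.ofReal (Real.exp (l * (wsup F (fun t => -(sgn (σ t) * q t)) (v.along σ) +
    ∑ t, sgn (σ t) * q t * (M / 2))))

theorem sum_append_mul {n : ℕ} (q : Fin n → ℝ) (f : Z → ℝ) (y y' : Fin n → Z) :
    ∑ i, Fin.append (-q) q i * f (Fin.append y y' i) = ∑ i, q i * (f (y' i) - f (y i)) := by
  rw [Fin.sum_univ_add, ← Finset.sum_add_distrib]
  refine Finset.sum_congr rfl fun i _ => ?_
  simp only [Fin.append_left, Fin.append_right, Pi.neg_apply]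
  ring

/-- The supremum of a sum is at most the sum of the suprema over first and second components. Second
components along `σ` are first components of the flipped tree along `-σ`, so both parts have the
same form; their centring terms are opposite and cancel. -/
theorem expSup_le {F : Set (Z → ℝ)} (hne : F.Nonempty) {M : ℝ} (hM : ∀ f ∈ F, ∀ z, |f z| ≤ M)
    {n : ℕ} (q : Fin n → ℝ) {l : ℝ} (hl : 0 < l) (σ : Fin n → Bool) (w : BinTree n (Z × Z)) :
    expSup F q l (w.path σ, w.copath σ) ≤
      2⁻¹ * (expSignedSup F M q (2 * l) σ w.fst +
        expSignedSup F M q (2 * l) (fun i => !σ i) w.flip.fst) := by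
  unfold expSup expSignedSup
  have h2 : (2⁻¹ : ℝ≥0∞) = ENNReal.ofReal 2⁻¹ := by
    rw [ENNReal.ofReal_inv_of_pos two_pos, ENNReal.ofReal_ofNat]
  rw [← ENNReal.ofReal_add (Real.exp_nonneg _) (Real.exp_nonneg _), h2,
    ← ENNReal.ofReal_mul (by norm_num)]
  refine ENNReal.ofReal_le_ofReal ?_
  set K := ∑ t, sgn (σ t) * q t * (M / 2)
  have hK : ∑ t, sgn (!σ t) * q t * (M / 2) = -K := by
    simp only [sgn_not, neg_mul, Finset.sum_neg_distrib, K]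
  rw [hK]
  set A := wsup F (fun t => -(sgn (σ t) * q t)) (w.fst.along σ) with hA
  set B := wsup F (fun t => -(sgn (!σ t) * q t)) (w.flip.fst.along fun i => !σ i) with hB
  have hAB : wsup F (Fin.append (-q) q) (Fin.append (w.path σ) (w.copath σ)) ≤ A + B := by
    have : Nonempty F := hne.to_subtype
    refine ciSup_le fun f => ?_
    refine le_trans (le_of_eq ?_) (add_le_add (le_wsup hM _ _ f.2) (le_wsup hM _ _ f.2))
    rw [sum_append_mul, ← Finset.sum_add_distrib]
    refine Finset.sum_congr rfl fun t _ => ?_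
    have h3 : w.flip.fst.along (fun i => !σ i) t = (w.along σ t).2 := by
      simp [BinTree.fst, BinTree.flip, BinTree.along]
    have h4 : w.fst.along σ t = (w.along σ t).1 := rfl
    rw [h3, h4]
    unfold BinTree.path BinTree.copath
    cases σ t <;> simp [sgn] <;> ring
  have h5 : Real.exp (l * wsup F (Fin.append (-q) q) (Fin.append (w.path σ) (w.copath σ))) ≤
      Real.exp (l * (A + K)) * Real.exp (l * (B + -K)) := by
    rw [← Real.exp_add, Real.exp_le_exp, ← mul_add]
    exact mul_le_mul_of_nonneg_left (by linarith) hl.le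
  have h6 : ∀ x, Real.exp (2 * l * x) = Real.exp (l * x) ^ 2 := fun x => by
    rw [← Real.exp_nat_mul]
    congr 1
    push_cast
    ring
  rw [h6, h6]
  -- This is `ab ≤ (a² + b²) / 2`; the squares are the source of the rate `2 * l`.
  nlinarith [sq_nonneg (Real.exp (l * (A + K)) - Real.exp (l * (B + -K)))]

variable [MeasurableSpace Z]

theorem MeasurableClass.aemeasurable_wsup {F : Set (Z → ℝ)} (hF : MeasurableClass F) {A : Type*}
    [MeasurableSpace A] (ν : Measure A) [IsFiniteMeasure ν] {n : ℕ} (c : Fin n → ℝ)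
    {g : A → Fin n → Z} (hg : Measurable g) : AEMeasurable (fun a => wsup F c (g a)) ν :=
  (hF.2 n c (ν.map g) inferInstance).comp_measurable hg

theorem MeasurableClass.aemeasurable_expSup {F : Set (Z → ℝ)} (hF : MeasurableClass F) {n : ℕ}
    (q : Fin n → ℝ) (l : ℝ) (ν : Measure ((Fin n → Z) × (Fin n → Z))) [IsFiniteMeasure ν] :
    AEMeasurable (expSup F q l) ν := by
  have h : Measurable fun a : (Fin n → Z) × (Fin n → Z) => Fin.append a.1 a.2 := by
    refine measurable_pi_lambda _ fun i => ?_
    induction i using Fin.addCases with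
    | left i => simp only [Fin.append_left]; fun_prop
    | right i => simp only [Fin.append_right]; fun_prop
  exact (Real.measurable_exp.comp_aemeasurable
    ((hF.aemeasurable_wsup ν _ h).const_mul l)).ennreal_ofReal

theorem MeasurableClass.aemeasurable_expSignedSup {F : Set (Z → ℝ)} (hF : MeasurableClass F)
    (M : ℝ) {n : ℕ} (q : Fin n → ℝ) (l : ℝ) (σ : Fin n → Bool) (ν : Measure (BinTree n Z))
    [IsFiniteMeasure ν] : AEMeasurable (expSignedSup F M q l σ) ν :=
  (Real.measurable_exp.comp_aemeasurable
    (((hF.aemeasurable_wsup ν _ (BinTree.measurable_along σ)).add_const _).const_mul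
      l)).ennreal_ofReal

theorem BinTree.measurable_fst {n : ℕ} :
    Measurable fun w : BinTree n (Z × Z) => w.fst := by
  refine measurable_pi_lambda _ fun t => measurable_pi_lambda _ fun σ => ?_
  unfold BinTree.fst
  fun_prop

variable (p : (k : ℕ) → Kernel (Fin k → Z) Z) [∀ k, IsMarkovKernel (p k)]

instance isProbabilityMeasure_treeLaw (T : ℕ) : IsProbabilityMeasure (treeLaw p T) :=
  Measure.isProbabilityMeasure_map BinTree.measurable_fst.aemeasurable

/-- The joint law of the process and its decoupled tangent sequence. -/
noncomputable def jointLaw (T : ℕ) : Measure ((Fin T → Z) × (Fin T → Z)) :=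
  (seqLaw p T 0 fun i => i.elim0) ⊗ₘ
    (tangentLaw p T 0).comap (fun y => (fun i => i.elim0, y)) measurable_prodMk_left

instance (T : ℕ) : IsProbabilityMeasure (jointLaw p T) := by
  unfold jointLaw
  infer_instance

theorem jointLaw_eq (T : ℕ) :
    jointLaw p T = ((2 : ℝ≥0∞) ^ T)⁻¹ • ∑ σ : Fin T → Bool,
      (pairTreeLaw p T 0 fun i => i.elim0).map fun w => (w.path σ, w.copath σ) := by
  refine Measure.ext_of_lintegral _ fun φ hφ => ?_
  rw [jointLaw, Measure.lintegral_compProd hφ, lintegral_smul_measure,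
    lintegral_finsetSum_measure, smul_eq_mul]
  simp only [Kernel.comap_apply]
  rw [lintegral_seqLaw_tangentLaw p T 0 _ hφ]
  congr 1
  refine Finset.sum_congr rfl fun σ _ => ?_
  rw [lintegral_map hφ (by fun_prop)]

theorem lintegral_expSup_jointLaw_le {F : Set (Z → ℝ)} (hF : MeasurableClass F)
    (hne : F.Nonempty) {M : ℝ} (hM0 : 0 ≤ M) (h0 : ∀ f ∈ F, ∀ z, 0 ≤ f z)
    (hM : ∀ f ∈ F, ∀ z, |f z| ≤ M) {T : ℕ} (q : Fin T → ℝ) (α : ℝ) {l : ℝ} (hl : 0 < l) :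
    ∫⁻ a, expSup F q l a ∂(jointLaw p T) ≤ expectedCoveringNumber p q α F *
      ENNReal.ofReal (Real.exp (2 * l * α + ∑ t, (2 * l * |q t| * (M / 2)) ^ 2 / 2)) := by
  set P := pairTreeLaw p T 0 fun i => i.elim0 with hP
  have hfst : treeLaw p T = P.map BinTree.fst := rfl
  have haem := fun σ => hF.aemeasurable_expSignedSup M q (2 * l) σ (treeLaw p T)
  have hI : ∀ σ, ∫⁻ w, expSignedSup F M q (2 * l) σ w.fst ∂P =
      ∫⁻ v, expSignedSup F M q (2 * l) σ v ∂(treeLaw p T) := fun σ => by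
    rw [hfst, lintegral_map' (hfst ▸ haem σ) BinTree.measurable_fst.aemeasurable]
  have haemP : ∀ σ, AEMeasurable (fun w : BinTree T (Z × Z) =>
      expSignedSup F M q (2 * l) σ w.fst) P := fun σ =>
    (haem σ).comp_measurable BinTree.measurable_fst
  have hflip : P.map BinTree.flip = P := map_flip_pairTreeLaw p T 0 _
  have hI' : ∀ σ, ∫⁻ w, expSignedSup F M q (2 * l) σ w.flip.fst ∂P =
      ∫⁻ v, expSignedSup F M q (2 * l) σ v ∂(treeLaw p T) := fun σ => by
    rw [← hI]
    conv_rhs => rw [← hflip]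
    rw [lintegral_map' (by rw [hflip]; exact haemP σ) BinTree.measurable_flip.aemeasurable]
  -- Negating all signs permutes the paths, so both halves of the bound have the same total.
  have hsum : ∑ σ : Fin T → Bool, ∫⁻ v, expSignedSup F M q (2 * l) (fun i => !σ i) v
      ∂(treeLaw p T) = ∑ σ, ∫⁻ v, expSignedSup F M q (2 * l) σ v ∂(treeLaw p T) :=
    (Equiv.arrowCongr (Equiv.refl (Fin T)) Equiv.boolNot).sum_comp fun σ =>
      ∫⁻ v, expSignedSup F M q (2 * l) σ v ∂(treeLaw p T)
  calc ∫⁻ a, expSup F q l a ∂(jointLaw p T)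
      = (2 ^ T)⁻¹ * ∑ σ, ∫⁻ w, expSup F q l (w.path σ, w.copath σ) ∂P := by
        rw [jointLaw_eq, lintegral_smul_measure, lintegral_finsetSum_measure, smul_eq_mul]
        congr 1
        refine Finset.sum_congr rfl fun σ _ => ?_
        have := Measure.isFiniteMeasure_map P fun w => (w.path σ, w.copath σ)
        rw [lintegral_map' (hF.aemeasurable_expSup q l _) (by fun_prop)]
    _ ≤ (2 ^ T)⁻¹ * ∑ σ, ∫⁻ w, 2⁻¹ * (expSignedSup F M q (2 * l) σ w.fst +
          expSignedSup F M q (2 * l) (fun i => !σ i) w.flip.fst) ∂P := by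
        gcongr with σ _ w
        exact expSup_le hne hM q hl σ w
    _ = (2 ^ T)⁻¹ * ∑ σ, ∫⁻ v, expSignedSup F M q (2 * l) σ v ∂(treeLaw p T) := by
        congr 1
        simp_rw [lintegral_const_mul' _ _ (ENNReal.inv_ne_top.2 two_ne_zero)]
        rw [← Finset.mul_sum]
        simp_rw [lintegral_add_left' (haemP _), hI, hI']
        rw [Finset.sum_add_distrib, hsum, ← two_mul, ← mul_assoc,
          ENNReal.inv_mul_cancel two_ne_zero ENNReal.ofNat_ne_top, one_mul]
    _ = ∫⁻ v, (2 ^ T)⁻¹ * ∑ σ, expSignedSup F M q (2 * l) σ v ∂(treeLaw p T) := by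
        rw [lintegral_const_mul' _ _ (by simp), lintegral_finsetSum' _ fun σ _ => haem σ]
    _ ≤ ∫⁻ v, (coveringNumber q α F v : ℝ≥0∞) * ENNReal.ofReal (Real.exp (2 * l * α +
          ∑ t, (2 * l * |q t| * (M / 2)) ^ 2 / 2)) ∂(treeLaw p T) :=
        lintegral_mono fun v => avg_exp_wsup_le_coveringNumber hne hM0 h0
          (fun f hf z => (le_abs_self _).trans (hM f hf z)) q (by positivity) v
    _ = _ := by
        rw [lintegral_mul_const' _ _ ENNReal.ofReal_ne_top]
        rfl

/-- Jensen's inequality for the tangent sequence with `z` held fixed. It holds for every sample path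
and every `f`, so no measurability of the supremum of the deviations is needed. -/
theorem exp_le_lintegral_expSup {F : Set (Z → ℝ)} (hF : MeasurableClass F) {M : ℝ}
    (hM : ∀ f ∈ F, ∀ z, |f z| ≤ M) {T : ℕ} (q : Fin T → ℝ) {l : ℝ} (hl : 0 < l) (z : ℕ → Z)
    {f : Z → ℝ} (hf : f ∈ F) :
    ENNReal.ofReal (Real.exp (l * ∑ t, q t * (condMean p f t z - f (z t)))) ≤
      ∫⁻ y', expSup F q l (fun i => z i, y')
        ∂(tangentLaw p T 0 (fun i => i.elim0, fun i => z i)) := by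
  set κ := tangentLaw p T 0 (fun i => i.elim0, fun i => z i) with hκ
  have hmap : ∀ t : Fin T, κ.map (fun y => y t) = p t (history z t) := by
    intro t
    rw [← map_eval_tangentLaw p T 0 z t t (by simp), hκ]
    simp only [zero_add]
    congr 4
    exact Subsingleton.elim _ _
  have hfm := hF.1 f hf
  have hint : ∀ t : Fin T, Integrable (fun y : Fin T → Z => f (y t)) κ := fun t =>
    Integrable.of_bound (hfm.comp (measurable_pi_apply t)).aestronglyMeasurable M
      (ae_of_all _ fun y => hM f hf _)
  set g : (Fin T → Z) → ℝ := fun y => l * ∑ t, q t * (f (y t) - f (z t)) with hg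
  have hgm : Measurable g := by fun_prop
  have hgi : Integrable g κ :=
    (integrable_finsetSum _ fun t _ => ((hint t).sub (integrable_const _)).const_mul _).const_mul _
  have hgI : ∫ y, g y ∂κ = l * ∑ t, q t * (condMean p f t z - f (z t)) := by
    have hi : ∀ t ∈ Finset.univ, Integrable (fun y : Fin T → Z => q t * (f (y t) - f (z t))) κ :=
      fun t _ => ((hint t).sub (integrable_const _)).const_mul _
    rw [hg, integral_const_mul, integral_finsetSum _ hi]
    congr 1
    refine Finset.sum_congr rfl fun t _ => ?_
    rw [integral_const_mul, integral_sub (hint t) (integrable_const _), integral_const,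
      condMean, ← hmap t, integral_map (measurable_pi_apply t).aemeasurable hfm.aestronglyMeasurable]
    simp
  have hgb : ∀ y, |g y| ≤ l * ∑ t, |q t| * (2 * M) := by
    intro y
    rw [hg, abs_mul, abs_of_pos hl]
    refine mul_le_mul_of_nonneg_left ((Finset.abs_sum_le_sum_abs _ _).trans
      (Finset.sum_le_sum fun t _ => ?_)) hl.le
    rw [abs_mul]
    refine mul_le_mul_of_nonneg_left ((abs_sub _ _).trans ?_) (abs_nonneg _)
    linarith [hM f hf (y t), hM f hf (z t)]
  have hei : Integrable (Real.exp ∘ g) κ :=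
    Integrable.of_bound (Real.measurable_exp.comp hgm).aestronglyMeasurable
      (Real.exp (l * ∑ t, |q t| * (2 * M))) (ae_of_all _ fun y => by
        rw [Function.comp_apply, Real.norm_eq_abs, abs_of_pos (Real.exp_pos _), Real.exp_le_exp]
        exact (le_abs_self _).trans (hgb y))
  have hJ := convexOn_exp.map_integral_le (μ := κ) (f := g) Real.continuous_exp.continuousOn
    isClosed_univ (by simp) hgi hei
  rw [hgI] at hJ
  refine (ENNReal.ofReal_le_ofReal hJ).trans ?_
  rw [ofReal_integral_eq_lintegral_ofReal (f := fun y => Real.exp (g y)) hei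
    (ae_of_all _ fun y => Real.exp_nonneg _)]
  refine lintegral_mono fun y => ENNReal.ofReal_le_ofReal (Real.exp_le_exp.2
    (mul_le_mul_of_nonneg_left ?_ hl.le))
  rw [← sum_append_mul]
  exact le_wsup hM _ _ hf

/-- The exponential tail bound for the uniform deviation of the weighted sums. -/
theorem measure_deviation_le {Ω : Type*} [MeasurableSpace Ω] (μ : Measure Ω)
    [IsProbabilityMeasure μ] {T : ℕ} {X : ℕ → Ω → Z} (hX : ∀ k, Measurable (X k))
    (hp : IsCondLaw μ T X p) {F : Set (Z → ℝ)} (hF : MeasurableClass F)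
    (hne : F.Nonempty) {M : ℝ} (hM0 : 0 ≤ M) (h0 : ∀ f ∈ F, ∀ z, 0 ≤ f z)
    (hM : ∀ f ∈ F, ∀ z, |f z| ≤ M) (q : Fin T → ℝ) (α ε : ℝ) {l : ℝ} (hl : 0 < l) :
    μ {ω | ∃ f ∈ F, ε < ∑ t, q t * (condMean p f t (fun k => X k ω) - f (X t ω))} ≤
      expectedCoveringNumber p q α F * ENNReal.ofReal
        (Real.exp (2 * l * α + l ^ 2 * M ^ 2 * (∑ t, q t ^ 2) / 2 - l * ε)) := by
  obtain ⟨G, hGm, hG, hGI⟩ := exists_measurable_majorant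
    (hF.aemeasurable_expSup q l (jointLaw p T))
  set W : (Fin T → Z) → ℝ≥0∞ := fun y => ∫⁻ y', G (y, y')
    ∂(tangentLaw p T 0 (fun i => i.elim0, y)) with hW
  have hWm : Measurable W := measurable_lintegral_kernel_comp _ (by fun_prop) (by fun_prop)
  have hXm : Measurable fun ω => fun i : Fin T => X i ω := measurable_pi_lambda _ fun i => hX i
  have hWI : ∫⁻ ω, W (fun i => X i ω) ∂μ = ∫⁻ a, expSup F q l a ∂(jointLaw p T) := by
    have h1 := lintegral_process p μ hX hp T 0 (by simp) (φ := fun a => W a.2) (by fun_prop)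
    simp only [zero_add] at h1
    rw [h1, ← hGI, jointLaw, Measure.lintegral_compProd hGm]
    have h2 : ∀ ω, history (fun i => X i ω) 0 = fun i => i.elim0 := fun ω => Subsingleton.elim _ _
    simp only [h2, lintegral_const, measure_univ, mul_one]
    rfl
  -- The deviation event may fail to be measurable; Markov's inequality is applied to a measurable
  -- event containing it.
  have hsub : {ω | ∃ f ∈ F, ε < ∑ t, q t * (condMean p f t (fun k => X k ω) - f (X t ω))} ⊆
      {ω | ENNReal.ofReal (Real.exp (l * ε)) ≤ W (fun i => X i ω)} := by
    rintro ω ⟨f, hf, hfε⟩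
    refine (ENNReal.ofReal_le_ofReal (Real.exp_le_exp.2 (mul_le_mul_of_nonneg_left hfε.le
      hl.le))).trans ?_
    exact (exp_le_lintegral_expSup p hF hM q hl (fun k => X k ω) hf).trans
      (lintegral_mono fun y' => hG _)
  have hmarkov := mul_meas_ge_le_lintegral (μ := μ) (hWm.comp hXm)
    (ENNReal.ofReal (Real.exp (l * ε)))
  have hbound := hmarkov.trans (hWI.le.trans
    (lintegral_expSup_jointLaw_le p hF hne hM0 h0 hM q α hl))
  refine (measure_mono hsub).trans ?_
  have h3 : ENNReal.ofReal (Real.exp (-(l * ε))) * ENNReal.ofReal (Real.exp (l * ε)) = 1 := by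
    rw [← ENNReal.ofReal_mul (Real.exp_nonneg _), ← Real.exp_add]
    simp
  have h4 := mul_le_mul_right hbound (ENNReal.ofReal (Real.exp (-(l * ε))))
  rw [← mul_assoc, h3, one_mul] at h4
  refine h4.trans (le_of_eq ?_)
  rw [mul_left_comm, ← ENNReal.ofReal_mul (Real.exp_nonneg _), ← Real.exp_add]
  congr 3
  have h5 : ∑ t, (2 * l * |q t| * (M / 2)) ^ 2 / 2 = l ^ 2 * M ^ 2 * (∑ t, q t ^ 2) / 2 := by
    rw [Finset.mul_sum, Finset.sum_div]
    refine Finset.sum_congr rfl fun t _ => ?_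
    rw [mul_pow, mul_pow, sq_abs]
    ring
  rw [h5]
  ring

end Symmetrization

/-! ### Choice of the rate and confidence level -/

section Deviation

variable {Z : Type*} [MeasurableSpace Z] (p : (k : ℕ) → Kernel (Fin k → Z) Z)
  [∀ k, IsMarkovKernel (p k)]

theorem abs_condMean_le {f : Z → ℝ} {M : ℝ} (hf : ∀ z, |f z| ≤ M) (k : ℕ) (z : ℕ → Z) :
    |condMean p f k z| ≤ M := by
  simpa [condMean] using
    norm_integral_le_of_norm_le_const (f := f) (μ := p k (history z k)) (ae_of_all _ fun y => hf y)

theorem le_disc {F : Set (Z → ℝ)} {M : ℝ} (hM : ∀ f ∈ F, ∀ z, |f z| ≤ M) {T : ℕ} (q : Fin T → ℝ)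
    (z : ℕ → Z) {f : Z → ℝ} (hf : f ∈ F) :
    condMean p f T z - ∑ t : Fin T, q t * condMean p f t z ≤ disc p F q z := by
  refine le_ciSup (f := fun f : F => condMean p f.1 T z - ∑ t : Fin T, q t * condMean p f.1 t z)
    ⟨M + ∑ t : Fin T, |q t| * M, ?_⟩ ⟨f, hf⟩
  rintro _ ⟨g, rfl⟩
  have h1 := abs_le.1 (abs_condMean_le p (hM g g.2) T z)
  have h2 : -∑ t : Fin T, q t * condMean p g.1 t z ≤ ∑ t : Fin T, |q t| * M := by
    rw [← Finset.sum_neg_distrib]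
    refine Finset.sum_le_sum fun t _ => (neg_le_abs _).trans ?_
    rw [abs_mul]
    exact mul_le_mul_of_nonneg_left (abs_condMean_le p (hM g g.2) t z) (abs_nonneg _)
  change condMean p g.1 T z - ∑ t : Fin T, q t * condMean p g.1 t z ≤ _
  linarith [h1.2]

theorem one_le_expectedCoveringNumber {F : Set (Z → ℝ)} (hne : F.Nonempty) {T : ℕ}
    (q : Fin T → ℝ) (α : ℝ) : 1 ≤ expectedCoveringNumber p q α F := by
  calc (1 : ℝ≥0∞) = ∫⁻ _, 1 ∂(treeLaw p T) := by simp
    _ ≤ _ := lintegral_mono fun v => by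
      simpa using ENat.toENNReal_mono (one_le_coveringNumber hne q α v)

/-- With `D = M ‖q‖₂`, `K = log (N / δ)` and threshold `2α + D √(2K)`, the exponent is `l² D² / 2 -
l D √(2K)`. It is minimal at `l = √(2K) / D`, with value `-K`, and `N exp(-K) = δ`. -/
theorem measure_deviation_le_confidence {Ω : Type*} [MeasurableSpace Ω] (μ : Measure Ω)
    [IsProbabilityMeasure μ] {T : ℕ} {X : ℕ → Ω → Z} (hX : ∀ k, Measurable (X k))
    (hp : IsCondLaw μ T X p) {F : Set (Z → ℝ)} (hF : MeasurableClass F)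
    (hne : F.Nonempty) {M : ℝ} (hM0 : 0 ≤ M) (h0 : ∀ f ∈ F, ∀ z, 0 ≤ f z)
    (hM : ∀ f ∈ F, ∀ z, |f z| ≤ M) (q : Fin T → ℝ) {α δ : ℝ} (hα : 0 < α) (hδ : 0 < δ)
    (hδ1 : δ ≤ 1) (hfin : expectedCoveringNumber p q α F ≠ ∞) :
    μ {ω | ∃ f ∈ F, 2 * α + M * √(∑ t, q t ^ 2) *
        √(2 * Real.log ((expectedCoveringNumber p q α F).toReal / δ)) <
        ∑ t, q t * (condMean p f t (fun k => X k ω) - f (X t ω))} ≤ ENNReal.ofReal δ := by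
  set N := (expectedCoveringNumber p q α F).toReal with hN
  have hN1 : 1 ≤ N := by
    rw [hN, ← ENNReal.toReal_one]
    exact ENNReal.toReal_mono hfin (one_le_expectedCoveringNumber p hne q α)
  have hN' : expectedCoveringNumber p q α F = ENNReal.ofReal N := (ENNReal.ofReal_toReal hfin).symm
  set S := ∑ t, q t ^ 2 with hS
  have hS0 : 0 ≤ S := Finset.sum_nonneg fun t _ => sq_nonneg _
  set D := M * √S with hD
  have hD2 : D ^ 2 = M ^ 2 * S := by rw [hD, mul_pow, Real.sq_sqrt hS0]
  have hD0 : 0 ≤ D := by positivity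
  set K := Real.log (N / δ) with hK
  have hNδ : 0 < N / δ := by positivity
  have hK0 : 0 ≤ K := Real.log_nonneg ((one_le_div hδ).2 (hδ1.trans hN1))
  have hexpK : N * Real.exp (-K) = δ := by
    rw [Real.exp_neg, hK, Real.exp_log hNδ]
    field_simp
  -- The optimal rate is undefined if `D = 0`; then every `M * |q t|` vanishes, hence so do the
  -- deviations, while the threshold is at least `2 * α > 0`.
  rcases hD0.eq_or_lt with hD0 | hD0
  · have hempty : {ω | ∃ f ∈ F, 2 * α + D * √(2 * K) <
        ∑ t, q t * (condMean p f t (fun k => X k ω) - f (X t ω))} = ∅ := by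
      refine Set.eq_empty_of_forall_notMem ?_
      rintro ω ⟨f, hf, h⟩
      have hzero : ∀ t, q t * (condMean p f t (fun k => X k ω) - f (X t ω)) = 0 := by
        intro t
        have h1 : M * |q t| = 0 := by
          have h2 : (M * |q t|) ^ 2 ≤ D ^ 2 := by
            rw [hD2, mul_pow, sq_abs]
            exact mul_le_mul_of_nonneg_left
              (Finset.single_le_sum (f := fun t => q t ^ 2) (fun t _ => sq_nonneg _)
                (Finset.mem_univ t)) (sq_nonneg _)
          rw [← hD0] at h2
          nlinarith [sq_nonneg (M * |q t|)]
        rw [← abs_nonpos_iff, abs_mul]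
        have h3 := abs_sub (condMean p f t (fun k => X k ω)) (f (X t ω))
        have h4 := abs_condMean_le p (hM f hf) t (fun k => X k ω)
        have h5 := hM f hf (X t ω)
        refine (mul_le_mul_of_nonneg_left (h3.trans (add_le_add h4 h5)) (abs_nonneg _)).trans ?_
        linarith
      rw [Finset.sum_eq_zero fun t _ => hzero t, ← hD0, zero_mul, add_zero] at h
      linarith
    rw [hempty, measure_empty]
    exact zero_le
  -- If `K = 0` the optimal rate would be `0`, which is not allowed; but then `δ = N ≥ 1` and the
  -- bound is trivial.
  rcases hK0.eq_or_lt with hK0 | hK0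
  · have h1 : 1 ≤ δ := by
      rw [← hexpK, ← hK0, neg_zero, Real.exp_zero, mul_one]
      exact hN1
    exact prob_le_one.trans (ENNReal.one_le_ofReal.2 h1)
  have hl : 0 < √(2 * K) / D := by positivity
  refine (measure_deviation_le p μ hX hp hF hne hM0 h0 hM q α (2 * α + D * √(2 * K)) hl).trans
    (le_of_eq ?_)
  rw [hN', ← ENNReal.ofReal_mul (by positivity), ← hexpK]
  congr 3
  have h2 : √(2 * K) ^ 2 = 2 * K := Real.sq_sqrt (by positivity)
  rw [← hS, mul_assoc ((√(2 * K) / D) ^ 2), ← hD2]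
  field_simp
  linear_combination (-D) * h2

end Deviation

end TimeSeries

/-! ### Uniformity over the scale, and the theorem -/

/-- Exceeding some member of a family of deterministic thresholds is no more likely than exceeding
a single one of them can be. -/
theorem TimeSeries.measure_exists_lt_le {Ω ι : Type*} [MeasurableSpace Ω] (μ : Measure Ω)
    (A : ι → Ω → ℝ) (I : Set ι) {S : Set ℝ} (hS : BddBelow S) {c : ENNReal}
    (h : ∀ ε ∈ S, μ {ω | ∃ i ∈ I, ε < A i ω} ≤ c) :
    μ {ω | ∃ ε ∈ S, ∃ i ∈ I, ε < A i ω} ≤ c := by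
  rcases S.eq_empty_or_nonempty with rfl | hne
  · simp
  -- Thresholds in `S` decreasing to its infimum make the events increase to one that contains the
  -- whole union. Continuity from below needs no measurability of these events.
  obtain ⟨u, hu, hlim, huS⟩ := exists_seq_tendsto_sInf hne hS
  have hsub : {ω | ∃ ε ∈ S, ∃ i ∈ I, ε < A i ω} ⊆ ⋃ n, {ω | ∃ i ∈ I, u n < A i ω} := by
    rintro ω ⟨ε, hε, i, hi, hlt⟩
    obtain ⟨n, hn⟩ := (hlim.eventually_lt_const ((csInf_le hS hε).trans_lt hlt)).exists
    exact Set.mem_iUnion.2 ⟨n, i, hi, hn⟩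
  refine (measure_mono hsub).trans ?_
  rw [Monotone.measure_iUnion]
  · exact iSup_le fun n => h _ (huS n)
  · rintro m n hmn ω ⟨i, hi, hlt⟩
    exact ⟨i, hi, (hu hmn).trans_lt hlt⟩

theorem corollary2 {Ω 𝒳 𝒴 : Type*} [MeasurableSpace Ω] [MeasurableSpace 𝒳] [MeasurableSpace 𝒴]
    (μ : Measure Ω) [IsProbabilityMeasure μ]
    (T : ℕ) (Z : ℕ → Ω → 𝒳 × 𝒴) (hZ : ∀ k, Measurable (Z k))
    (p : (k : ℕ) → Kernel (Fin k → 𝒳 × 𝒴) (𝒳 × 𝒴)) [∀ k, IsMarkovKernel (p k)]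
    (hp : TimeSeries.IsCondLaw μ T Z p)
    (L : 𝒴 → 𝒴 → ℝ) (hL : ∀ y y', 0 ≤ L y y') (H : Set (𝒳 → 𝒴))
    (hF : TimeSeries.MeasurableClass (TimeSeries.lossClass L H))
    (M : ℝ) (hM : ∀ f ∈ TimeSeries.lossClass L H, ∀ z, |f z| ≤ M)
    (q : Fin T → ℝ) (δ : ℝ) (hδ : 0 < δ) :
    μ {ω | ¬ ∀ f ∈ TimeSeries.lossClass L H, ∀ α : ℝ, 0 < α →
        TimeSeries.expectedCoveringNumber p q α (TimeSeries.lossClass L H) ≠ ∞ →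
        TimeSeries.condMean p f T (fun k => Z k ω) ≤
          ∑ t : Fin T, q t * f (Z t ω)
            + TimeSeries.disc p (TimeSeries.lossClass L H) q (fun k => Z k ω)
            + 2 * α
            + M * √(∑ t : Fin T, q t ^ 2) *
              √(2 * Real.log
                ((TimeSeries.expectedCoveringNumber p q α
                  (TimeSeries.lossClass L H)).toReal / δ))}
      ≤ ENNReal.ofReal δ := by
  set F := TimeSeries.lossClass L H with hFdef
  rcases F.eq_empty_or_nonempty with hempty | hne
  · simp [hempty]
  rcases le_total 1 δ with hδ1 | hδ1
  · exact prob_le_one.trans (ENNReal.one_le_ofReal.2 hδ1)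
  have h0 : ∀ f ∈ F, ∀ z, 0 ≤ f z := by
    rintro _ ⟨h, -, rfl⟩ z
    exact hL _ _
  obtain ⟨ω₀⟩ := nonempty_of_isProbabilityMeasure μ
  have hM0 : 0 ≤ M := by
    obtain ⟨f, hf⟩ := hne
    exact (abs_nonneg _).trans (hM f hf (Z 0 ω₀))
  -- The threshold depends on `α` but not on the sample, which is why no union bound over scales is
  -- needed.
  let g : ℝ → ℝ := fun α => 2 * α + M * √(∑ t : Fin T, q t ^ 2) *
    √(2 * Real.log ((TimeSeries.expectedCoveringNumber p q α F).toReal / δ))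
  let S : Set ℝ := g '' {α | 0 < α ∧ TimeSeries.expectedCoveringNumber p q α F ≠ ∞}
  have hS : BddBelow S := by
    refine ⟨0, ?_⟩
    rintro _ ⟨α, ⟨hα, -⟩, rfl⟩
    positivity
  refine le_trans (measure_mono ?_) (TimeSeries.measure_exists_lt_le μ
    (fun f ω => ∑ t : Fin T, q t * (TimeSeries.condMean p f t (fun k => Z k ω) - f (Z t ω))) F hS
    (c := ENNReal.ofReal δ) ?_)
  · intro ω hω
    simp only [Set.mem_ofPred_eq, not_forall, not_le] at hω
    obtain ⟨f, hf, α, hα, hfin, hlt⟩ := hω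
    refine ⟨g α, ⟨α, ⟨hα, hfin⟩, rfl⟩, f, hf, ?_⟩
    -- The discrepancy absorbs the gap between the next conditional mean and the weighted past ones;
    -- what remains is the deviation.
    have h1 := TimeSeries.le_disc p hM q (fun k => Z k ω) hf
    simp only [mul_sub, Finset.sum_sub_distrib, g]
    linarith
  · rintro _ ⟨α, ⟨hα, hfin⟩, rfl⟩
    exact TimeSeries.measure_deviation_le_confidence p μ hZ hp hF hne hM0 h0 hM q hα hδ hδ1 hfin
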